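/- Let $d_x\ge 0$, $d_z\ge1$ be integers and let $p_{\mathrm{data}}$ be a Borel probability measure on $\mathbb{R}^{d_x}$ with finite covariance (finite second moment) that is not a point mass. Let $L\in(0,\infty]$. For a decoder variance $\sigma_x^2>0$, a measurable decoder mean $\mu_\theta:\mathbb{R}^{d_z}\to\mathbb{R}^{d_x}$, an encoder mean $\mu_\phi:\mathbb{R}^{d_x}\to\mathbb{R}^{d_z}$ and a latent variance $\sigma_z^2>0$, put $q_{\phi,\sigma_z^2}(\cdot\,|\,x)=\mathcal N(\mu_\phi(x),\sigma_z^2 I)$, $p=\mathcal N(0,I)$ and $$\mathcal J_{\sigma_x^2}(\theta,\phi,\sigma_z^2)=\mathbb E_{x\sim p_{\mathrm{data}}}\Big[\frac1{2\sigma_x^2}\,\mathbb E_{z\sim q_{\phi,\sigma_z^2}(\cdot|x)}\|x-\mu_\theta(z)\|_2^2+D_{\mathrm{KL}}\big(q_{\phi,\sigma_z^2}(\cdot\,|\,x)\,\big\|\,p\big)\Big]\in[0,\infty].$$ Consider global minimizers of $\mathcal J_{\sigma_x^2}$ over all measurable $\mu_\theta$, all $\mu_\phi$ that are Lipschitz continuous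 with a finite constant at most $L$ (for $L=\infty$: all Lipschitz continuous $\mu_\phi$), and all $\sigma_z^2>0$. Then $\sigma_z^2\to0$ at the global minimizers as $\sigma_x^2\to0$: for every $\varepsilon>0$ there is $\delta>0$ such that, whenever $0<\sigma_x^2<\delta$, every global minimizer $(\mu_\theta,\mu_\phi,\sigma_z^2)$ of $\mathcal J_{\sigma_x^2}$ satisfies $\sigma_z^2<\varepsilon$. -/

import Mathlib

open MeasureTheory ProbabilityTheory Filter Topology
open scoped ENNReal NNReal

/-- The parameters of a Gaussian VAE with isotropic latent variance: the decoder mean `μ_θ`, the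
encoder mean `μ_φ` and the latent variance `σ_z²`. -/
structure VAEParams (dx dz : ℕ) where
  /-- the decoder mean `μ_θ` -/
  decMean : EuclideanSpace ℝ (Fin dz) → EuclideanSpace ℝ (Fin dx)
  /-- the encoder mean `μ_φ` -/
  encMean : EuclideanSpace ℝ (Fin dx) → EuclideanSpace ℝ (Fin dz)
  /-- the latent variance `σ_z²` -/
  latentVar : ℝ

namespace VAEParams

variable {dx dz : ℕ}

/-- Admissible parameters: a measurable decoder mean, an encoder mean that is Lipschitz continuous
with a finite constant that is at most `L`, and a positive latent variance. For `L = ∞` every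
Lipschitz continuous encoder mean is admissible. -/
structure Admissible (L : ℝ≥0∞) (P : VAEParams dx dz) : Prop where
  measurable_decMean : Measurable P.decMean
  lipschitz_encMean : ∃ K : ℝ≥0, (K : ℝ≥0∞) ≤ L ∧ LipschitzWith K P.encMean
  latentVar_pos : 0 < P.latentVar

/-- The encoder distribution `q(z|x) = N(μ_φ(x), σ_z² I)`. -/
noncomputable def encoder (P : VAEParams dx dz) (x : EuclideanSpace ℝ (Fin dx)) :
    Measure (EuclideanSpace ℝ (Fin dz)) :=
  multivariateGaussian (P.encMean x) (P.latentVar • (1 : Matrix (Fin dz) (Fin dz) ℝ))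

/-- The prior `p(z) = N(0, I)`. -/
noncomputable def prior (dz : ℕ) : Measure (EuclideanSpace ℝ (Fin dz)) :=
  multivariateGaussian 0 (1 : Matrix (Fin dz) (Fin dz) ℝ)

/-- The VAE objective with decoder variance `σ_x² = v`,
`E_{p(x)} [ 1/(2v) E_{q(z|x)} ‖x - μ_θ(z)‖² + KL(q(z|x) ‖ p(z)) ]`, with values in `[0, ∞]`. -/
noncomputable def objective (pdata : Measure (EuclideanSpace ℝ (Fin dx))) (v : ℝ)
    (P : VAEParams dx dz) : ℝ≥0∞ :=
  ∫⁻ x, (ENNReal.ofReal (1 / (2 * v)) * ∫⁻ z, ENNReal.ofReal (‖x - P.decMean z‖ ^ 2) ∂(P.encoder x)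
    + InformationTheory.klDiv (P.encoder x) (prior dz)) ∂pdata

/-- `P` is a global optimum (minimizer) of the VAE objective with decoder variance `v` among all
admissible parameters. -/
def IsGlobalOptimum (pdata : Measure (EuclideanSpace ℝ (Fin dx))) (L : ℝ≥0∞) (v : ℝ)
    (P : VAEParams dx dz) : Prop :=
  P.Admissible L ∧ ∀ Q : VAEParams dx dz, Q.Admissible L → P.objective pdata v ≤ Q.objective pdata v

end VAEParams

/-! ### Standard Gaussian measure: density, moments, splitting into independent halves. -/

section StdGaussian

variable {V : Type*} [NormedAddCommGroup V] [InnerProductSpace ℝ V] [FiniteDimensional ℝ V]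
  [MeasurableSpace V] [BorelSpace V]

/-! Suppose an optimum has latent variance at least `ε`. Averaging the decoder over half of the
latent noise and halving the latent variance (`halve`) lowers the reconstruction error by exactly
the decoder's mean conditional variance (`reconError_eq_add_smoothingGap`), while the KL term of the
result is bounded in terms of `ε`. Since KL carries weight `2v` relative to the reconstruction
error, optimality forces this gap to be `O(v)`.

A small gap makes the averaged decoder almost constant. Gaussians with centers in a ball and
variances bounded below all dominate one positive weight, so a single decoder value `c` is close in
mean square to the averaged decoder over all these centers
(`exists_setLIntegral_mul_le_smoothingGap`). The ball can be fixed beforehand, because comparing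
with shrunken latents bounds the latent second moment at every optimum (`second_moment_le`).

An almost constant decoder has error nearly at least the total variance `V` of the data. But a
linear one-coordinate autoencoder achieves some `r < V` (`exists_admissible_reconError_lt`), so the
optimum's error is at most `r + O(v)`: a contradiction for small `v`. -/

open Module Real in
theorem stdGaussian_eq_withDensity :
    stdGaussian V = (volume : Measure V).withDensity
      (fun x ↦ ENNReal.ofReal (((2 * π) ^ ((finrank ℝ V : ℝ) / 2))⁻¹ * exp (-(1 / 2) * ‖x‖ ^ 2))) := by
  have hI : Integrable (fun x : V ↦ ((2 * π) ^ ((finrank ℝ V : ℝ) / 2))⁻¹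
      * exp (-(1 / 2) * ‖x‖ ^ 2)) := by
    refine Integrable.const_mul ?_ _
    -- A non-integrable function has Bochner integral 0, so the nonzero closed form of the integral
    -- already gives integrability.
    refine not_imp_comm.1 integral_undef ?_
    rw [GaussianFourier.integral_rexp_neg_mul_sq_norm (by norm_num)]
    positivity
  have hfin : IsFiniteMeasure ((volume : Measure V).withDensity
      (fun x ↦ ENNReal.ofReal (((2 * π) ^ ((finrank ℝ V : ℝ) / 2))⁻¹
        * exp (-(1 / 2) * ‖x‖ ^ 2)))) :=
    isFiniteMeasure_withDensity_ofReal hI.2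
  refine Measure.ext_of_charFun ?_
  ext t
  rw [charFun_stdGaussian, charFun_apply, integral_withDensity_eq_integral_toReal_smul
    (by fun_prop) (by simp)]
  have h := GaussianFourier.integral_cexp_neg_mul_sq_norm_add (V := V) (b := 1 / 2)
    (by norm_num) Complex.I t
  have hc : ∀ x : V, (ENNReal.ofReal (((2 * π) ^ ((finrank ℝ V : ℝ) / 2))⁻¹
        * exp (-(1 / 2) * ‖x‖ ^ 2))).toReal • Complex.exp (inner ℝ x t * Complex.I)
      = (((2 * π) ^ ((finrank ℝ V : ℝ) / 2) : ℝ) : ℂ)⁻¹ *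
        Complex.exp (-(1 / 2) * ‖x‖ ^ 2 + Complex.I * inner ℝ t x) := by
    intro x
    rw [ENNReal.toReal_ofReal (by positivity), Complex.real_smul, Complex.exp_add,
      real_inner_comm t x, mul_comm Complex.I]
    push_cast
    ring
  simp_rw [hc]
  rw [integral_const_mul, h, Complex.ofReal_cpow (by positivity)]
  have h2 : ((π : ℂ) / (1 / 2)) = ((2 * π : ℝ) : ℂ) := by push_cast; ring
  rw [h2]
  push_cast
  rw [← mul_assoc, inv_mul_cancel₀, one_mul, Complex.I_sq]
  · congr 1; ring
  · rw [Complex.cpow_ne_zero_iff]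
    left
    simp [pi_ne_zero]

open Module in
/-- The density of the law of `m + √s ξ` with respect to the law of the standard Gaussian `ξ`. -/
noncomputable def gaussianRatio (m : V) (s : ℝ) (z : V) : ℝ :=
  Real.exp (-((finrank ℝ V : ℝ) / 2 * Real.log s) - ‖z - m‖ ^ 2 / (2 * s) + ‖z‖ ^ 2 / 2)

omit [FiniteDimensional ℝ V] [MeasurableSpace V] [BorelSpace V] in
@[fun_prop]
theorem continuous_gaussianRatio (m : V) (s : ℝ) : Continuous (gaussianRatio m s) := by
  unfold gaussianRatio
  fun_prop

omit [FiniteDimensional ℝ V] [MeasurableSpace V] [BorelSpace V] in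
theorem gaussianRatio_pos (m : V) (s : ℝ) (z : V) : 0 < gaussianRatio m s z := Real.exp_pos _

open Module in
theorem lintegral_volume_comp_add_smul (m : V) {c : ℝ} (hc : 0 < c) {f : V → ℝ≥0∞}
    (hf : Measurable f) :
    ∫⁻ z, f z = ENNReal.ofReal (c ^ finrank ℝ V) * ∫⁻ z, f (m + c • z) := by
  have h1 : ∫⁻ z : V, f (m + c • z) = ∫⁻ z, f (m + z) ∂(Measure.map (c • ·) volume) := by
    rw [lintegral_map (by fun_prop) (by fun_prop)]
  rw [h1, Measure.map_addHaar_smul _ hc.ne', lintegral_smul_measure, smul_eq_mul, ← mul_assoc,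
    ← ENNReal.ofReal_mul (by positivity), abs_of_pos (by positivity),
    mul_inv_cancel₀ (by positivity), lintegral_add_left_eq_self]
  simp

open Module Real in
-- Change of variables `z = m + √s ξ`; the Jacobian cancels the `log s` term of the ratio. Taking
-- the standard Gaussian as reference serves both the KL formula and the common lower bound for
-- shifted Gaussians.
theorem map_stdGaussian_eq_withDensity (m : V) {s : ℝ} (hs : 0 < s) :
    (stdGaussian V).map (fun ξ ↦ m + √s • ξ)
      = (stdGaussian V).withDensity (fun z ↦ ENNReal.ofReal (gaussianRatio m s z)) := by
  refine Measure.ext_of_lintegral _ fun f hf ↦ ?_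
  rw [lintegral_map hf (by fun_prop),
    lintegral_withDensity_eq_lintegral_mul _ (by fun_prop) hf]
  rw [stdGaussian_eq_withDensity, lintegral_withDensity_eq_lintegral_mul _ (by fun_prop)
    (by fun_prop), lintegral_withDensity_eq_lintegral_mul _ (by fun_prop)
    (by simp only [Pi.mul_def]; fun_prop)]
  conv_rhs => rw [lintegral_volume_comp_add_smul m (Real.sqrt_pos.2 hs)
    (by simp only [Pi.mul_def]; fun_prop), ← lintegral_const_mul _
    (by simp only [Pi.mul_def]; fun_prop)]
  refine lintegral_congr fun z ↦ ?_
  simp only [Pi.mul_apply]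
  rw [← mul_assoc, ← mul_assoc, ← ENNReal.ofReal_mul (by positivity),
    ← ENNReal.ofReal_mul (by positivity)]
  congr 2
  unfold gaussianRatio
  have h1 : √s ^ finrank ℝ V = exp ((finrank ℝ V : ℝ) / 2 * Real.log s) := by
    rw [← Real.rpow_natCast, Real.sqrt_eq_rpow, ← Real.rpow_mul hs.le, Real.rpow_def_of_pos hs]
    congr 1; ring
  rw [h1]
  have h2 : ‖m + √s • z - m‖ ^ 2 / (2 * s) = ‖z‖ ^ 2 / 2 := by
    rw [add_sub_cancel_left, norm_smul, mul_pow, Real.norm_eq_abs, sq_abs, Real.sq_sqrt hs.le]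
    field_simp
  rw [h2]
  set A := ‖z‖ ^ 2
  set B := ‖m + √s • z‖ ^ 2
  set l := (finrank ℝ V : ℝ) / 2 * Real.log s
  have h3 : exp (-(1 / 2) * A) = exp l * (exp (-(1 / 2) * B) * exp (-l - A / 2 + B / 2)) := by
    rw [← Real.exp_add, ← Real.exp_add]
    congr 1
    ring
  rw [h3]
  ring

theorem integrable_norm_sq_stdGaussian : Integrable (fun ξ : V ↦ ‖ξ‖ ^ 2) (stdGaussian V) :=
  (IsGaussian.memLp_two_id (μ := stdGaussian V)).integrable_norm_pow (by norm_num)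

theorem integrable_inner_stdGaussian (m : V) :
    Integrable (fun ξ : V ↦ inner ℝ m ξ) (stdGaussian V) :=
  (IsGaussian.integrable_id (μ := stdGaussian V)).const_inner m

theorem integral_inner_stdGaussian (m : V) : ∫ ξ, inner ℝ m ξ ∂(stdGaussian V) = 0 := by
  have := integral_inner (𝕜 := ℝ) (IsGaussian.integrable_id (μ := stdGaussian V)) m
  simpa using this

theorem integral_inner_sq_stdGaussian (m : V) :
    ∫ ξ, (inner ℝ m ξ) ^ 2 ∂(stdGaussian V) = ‖m‖ ^ 2 := by
  have := variance_dual_stdGaussian (InnerProductSpace.toDual ℝ V m)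
  rw [variance_of_integral_eq_zero (by fun_prop)
    (by simpa using integral_inner_stdGaussian m)] at this
  simpa using this

open Module in
theorem integral_norm_sq_stdGaussian : ∫ ξ, ‖ξ‖ ^ 2 ∂(stdGaussian V) = finrank ℝ V := by
  have h : ∀ ξ : V, ‖ξ‖ ^ 2 = ∑ i, (inner ℝ (stdOrthonormalBasis ℝ V i) ξ) ^ 2 :=
    fun ξ ↦ ((stdOrthonormalBasis ℝ V).sum_sq_inner_right ξ).symm
  simp_rw [h]
  rw [integral_finsetSum]
  · simp [integral_inner_sq_stdGaussian]
  · intro i _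
    have := (IsGaussian.memLp_two_id (μ := stdGaussian V)).const_inner (𝕜 := ℝ)
      (stdOrthonormalBasis ℝ V i)
    exact this.integrable_sq

/-- A centered Gaussian of variance `s` is the sum of two independent ones of variance `s / 2`, by
characteristic functions. This splits the encoder noise into a half that is kept and a half that is
averaged out. -/
theorem lintegral_stdGaussian_sqrt_smul {s : ℝ} (hs : 0 ≤ s) {h : V → ℝ≥0∞} (hh : Measurable h) :
    ∫⁻ ξ, h (√s • ξ) ∂(stdGaussian V)
      = ∫⁻ a, ∫⁻ b, h (√(s / 2) • a + √(s / 2) • b) ∂(stdGaussian V) ∂(stdGaussian V) := by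
  have key : (((stdGaussian V).map (√(s / 2) • ·)).prod ((stdGaussian V).map (√(s / 2) • ·))).map
      (fun p ↦ p.1 + p.2) = (stdGaussian V).map (√s • ·) := by
    have : IsProbabilityMeasure ((stdGaussian V).map (√(s / 2) • ·)) :=
      Measure.isProbabilityMeasure_map (by fun_prop)
    have : IsProbabilityMeasure ((stdGaussian V).map (√s • ·)) :=
      Measure.isProbabilityMeasure_map (by fun_prop)
    refine Measure.ext_of_charFun ?_
    rw [charFun_map_add_prod_eq_mul]
    ext t
    simp only [Pi.mul_apply, charFun_map_smul, charFun_stdGaussian, ← Complex.exp_add, norm_smul,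
      Real.norm_eq_abs, abs_of_nonneg (Real.sqrt_nonneg _)]
    congr 1
    norm_cast
    rw [mul_pow, mul_pow, Real.sq_sqrt hs, Real.sq_sqrt (by positivity)]
    ring
  have h1 := congrArg (fun μ ↦ ∫⁻ z, h z ∂μ) key
  simp only at h1
  rw [lintegral_map hh (by fun_prop), lintegral_map hh (by fun_prop),
    Measure.map_prod_map _ _ (by fun_prop) (by fun_prop), lintegral_map (by fun_prop) (by fun_prop),
    lintegral_prod _ (by fun_prop)] at h1
  exact h1.symm

end StdGaussian

/-! ### Kullback-Leibler divergence from the standard Gaussian. -/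

section StdGaussian

variable {V : Type*} [NormedAddCommGroup V] [InnerProductSpace ℝ V] [FiniteDimensional ℝ V]
  [MeasurableSpace V] [BorelSpace V]

omit [FiniteDimensional ℝ V] [MeasurableSpace V] [BorelSpace V] in
theorem norm_add_sqrt_smul_sq (m ξ : V) {s : ℝ} (hs : 0 ≤ s) :
    ‖m + √s • ξ‖ ^ 2 = ‖m‖ ^ 2 + 2 * √s * inner ℝ m ξ + s * ‖ξ‖ ^ 2 := by
  rw [norm_add_sq_real, norm_smul, mul_pow, Real.norm_eq_abs, sq_abs, Real.sq_sqrt hs,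
    real_inner_smul_right]
  ring

open Module in
-- Along `m + √s ξ` the log-likelihood ratio is a constant plus a linear and a quadratic term in
-- `ξ`; the linear term has mean zero.
theorem klDiv_map_stdGaussian (m : V) {s : ℝ} (hs : 0 < s) :
    InformationTheory.klDiv ((stdGaussian V).map (fun ξ ↦ m + √s • ξ)) (stdGaussian V)
      = ENNReal.ofReal ((finrank ℝ V * s + ‖m‖ ^ 2 - finrank ℝ V
          - finrank ℝ V * Real.log s) / 2) := by
  have : IsProbabilityMeasure ((stdGaussian V).map (fun ξ ↦ m + √s • ξ)) :=
    Measure.isProbabilityMeasure_map (by fun_prop)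
  have hd := map_stdGaussian_eq_withDensity m hs
  have hac : (stdGaussian V).map (fun ξ ↦ m + √s • ξ) ≪ stdGaussian V := by
    rw [hd]
    exact withDensity_absolutelyContinuous _ _
  have hllr : llr ((stdGaussian V).map (fun ξ ↦ m + √s • ξ)) (stdGaussian V)
      =ᵐ[(stdGaussian V).map (fun ξ ↦ m + √s • ξ)] fun z ↦ Real.log (gaussianRatio m s z) := by
    refine hac.ae_le ?_
    have := Measure.rnDeriv_withDensity (stdGaussian V)
      (f := fun z ↦ ENNReal.ofReal (gaussianRatio m s z)) (by fun_prop)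
    rw [← hd] at this
    filter_upwards [this] with z hz
    rw [llr, hz, ENNReal.toReal_ofReal (gaussianRatio_pos m s z).le]
  have hlog : ∀ ξ : V, Real.log (gaussianRatio m s (m + √s • ξ))
      = (‖m‖ ^ 2 - finrank ℝ V * Real.log s) / 2 + √s * inner ℝ m ξ
        + (s - 1) / 2 * ‖ξ‖ ^ 2 := by
    intro ξ
    rw [gaussianRatio, Real.log_exp, norm_add_sqrt_smul_sq m ξ hs.le, add_sub_cancel_left,
      norm_smul, mul_pow, Real.norm_eq_abs, sq_abs, Real.sq_sqrt hs.le]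
    field_simp
    ring
  have hm : Measurable fun z ↦ Real.log (gaussianRatio m s z) :=
    Real.measurable_log.comp (continuous_gaussianRatio m s).measurable
  have hi1 : Integrable (fun ξ : V ↦ (‖m‖ ^ 2 - finrank ℝ V * Real.log s) / 2
      + √s * inner ℝ m ξ) (stdGaussian V) :=
    (integrable_const _).add ((integrable_inner_stdGaussian m).const_mul _)
  have hi2 : Integrable (fun ξ : V ↦ (s - 1) / 2 * ‖ξ‖ ^ 2) (stdGaussian V) :=
    integrable_norm_sq_stdGaussian.const_mul _
  have hint : Integrable (llr ((stdGaussian V).map (fun ξ ↦ m + √s • ξ)) (stdGaussian V))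
      ((stdGaussian V).map (fun ξ ↦ m + √s • ξ)) := by
    rw [integrable_congr hllr, integrable_map_measure hm.aestronglyMeasurable (by fun_prop)]
    exact (hi1.add hi2).congr (ae_of_all _ fun ξ ↦ (hlog ξ).symm)
  rw [InformationTheory.klDiv_of_ac_of_integrable hac hint, integral_congr_ae hllr,
    integral_map (by fun_prop) hm.aestronglyMeasurable]
  simp_rw [hlog]
  rw [integral_add hi1 hi2, integral_add (integrable_const _)
    ((integrable_inner_stdGaussian m).const_mul _), integral_const_mul, integral_const_mul,
    integral_inner_stdGaussian, integral_norm_sq_stdGaussian]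
  simp only [integral_const, probReal_univ, smul_eq_mul]
  congr 1
  ring

end StdGaussian

/-! ### The objective as weighted reconstruction error plus closed-form KL. -/

namespace VAEParams

variable {dx dz : ℕ}

open scoped MatrixOrder in
theorem encoder_eq_map (P : VAEParams dx dz) (hs : 0 ≤ P.latentVar)
    (x : EuclideanSpace ℝ (Fin dx)) :
    P.encoder x = (stdGaussian (EuclideanSpace ℝ (Fin dz))).map
      (fun ξ ↦ P.encMean x + √P.latentVar • ξ) := by
  have h : CFC.sqrt (P.latentVar • (1 : Matrix (Fin dz) (Fin dz) ℝ))
      = √P.latentVar • (1 : Matrix (Fin dz) (Fin dz) ℝ) := by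
    refine CFC.sqrt_unique ?_ ?_
    · rw [smul_mul_smul_comm, mul_one, Real.mul_self_sqrt hs]
    · exact (Matrix.PosSemidef.one.smul (Real.sqrt_nonneg _)).nonneg
  rw [encoder, multivariateGaussian, h]
  simp

/-- The mean squared reconstruction error `E ‖x - μ_θ(μ_φ(x) + σ_z ξ)‖²`. -/
noncomputable def reconError (pdata : Measure (EuclideanSpace ℝ (Fin dx)))
    (P : VAEParams dx dz) : ℝ≥0∞ :=
  ∫⁻ x, ∫⁻ ξ, ENNReal.ofReal (‖x - P.decMean (P.encMean x + √P.latentVar • ξ)‖ ^ 2)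
    ∂(stdGaussian (EuclideanSpace ℝ (Fin dz))) ∂pdata

/-- The mean Kullback-Leibler divergence of the encoder from the prior, in closed form. -/
noncomputable def meanKL (pdata : Measure (EuclideanSpace ℝ (Fin dx)))
    (P : VAEParams dx dz) : ℝ :=
  (dz * P.latentVar + ∫ x, ‖P.encMean x‖ ^ 2 ∂pdata - dz - dz * Real.log P.latentVar) / 2

variable {pdata : Measure (EuclideanSpace ℝ (Fin dx))} [IsProbabilityMeasure pdata]
  {L : ℝ≥0∞} {P : VAEParams dx dz}

omit [IsProbabilityMeasure pdata] in
theorem Admissible.continuous_encMean (hP : P.Admissible L) : Continuous P.encMean := by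
  obtain ⟨K, -, hK⟩ := hP.lipschitz_encMean
  exact hK.continuous

theorem Admissible.memLp_encMean (hP : P.Admissible L) (hcov : MemLp id 2 pdata) :
    MemLp P.encMean 2 pdata := by
  obtain ⟨K, -, hK⟩ := hP.lipschitz_encMean
  have h1 : MemLp (fun x ↦ P.encMean x - P.encMean 0) 2 pdata := by
    refine hcov.of_le_mul (c := K)
      (hK.continuous.sub continuous_const).aestronglyMeasurable (ae_of_all _ fun x ↦ ?_)
    simpa using hK.norm_sub_le x 0
  have h2 := h1.add (memLp_const (P.encMean 0))
  exact h2.ae_eq (ae_of_all _ fun x ↦ by simp)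

theorem Admissible.integrable_norm_encMean_sq (hP : P.Admissible L) (hcov : MemLp id 2 pdata) :
    Integrable (fun x ↦ ‖P.encMean x‖ ^ 2) pdata :=
  (hP.memLp_encMean hcov).integrable_norm_pow (by norm_num)

theorem gaussian_kl_nonneg (n : ℕ) {a s : ℝ} (ha : 0 ≤ a) (hs : 0 < s) :
    0 ≤ (n * s + a - n - n * Real.log s) / 2 := by
  have h1 : Real.log s ≤ s - 1 := Real.log_le_sub_one_of_pos hs
  have h2 : (n : ℝ) * Real.log s ≤ n * (s - 1) := by gcongr
  linarith

/-- The Lipschitz encoder inherits a finite second moment from the data, so the KL part is always a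
finite real; only the reconstruction error can be infinite. -/
theorem objective_eq (hP : P.Admissible L) (hcov : MemLp id 2 pdata) (v : ℝ) :
    P.objective pdata v
      = ENNReal.ofReal (1 / (2 * v)) * P.reconError pdata + ENNReal.ofReal (P.meanKL pdata) := by
  have hs := hP.latentVar_pos
  have hf := hP.measurable_decMean
  have hμ := hP.continuous_encMean.measurable
  have hrec : ∀ x, ∫⁻ z, ENNReal.ofReal (‖x - P.decMean z‖ ^ 2) ∂(P.encoder x)
      = ∫⁻ ξ, ENNReal.ofReal (‖x - P.decMean (P.encMean x + √P.latentVar • ξ)‖ ^ 2)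
        ∂(stdGaussian (EuclideanSpace ℝ (Fin dz))) := by
    intro x
    rw [P.encoder_eq_map hs.le, lintegral_map (by fun_prop) (by fun_prop)]
  have hkl : ∀ x, InformationTheory.klDiv (P.encoder x) (prior dz)
      = ENNReal.ofReal ((dz * P.latentVar + ‖P.encMean x‖ ^ 2 - dz
          - dz * Real.log P.latentVar) / 2) := by
    intro x
    rw [P.encoder_eq_map hs.le, prior, multivariateGaussian_zero_one, klDiv_map_stdGaussian _ hs]
    simp
  have hi := hP.integrable_norm_encMean_sq hcov
  have hm : Measurable fun x ↦
      ∫⁻ ξ, ENNReal.ofReal (‖x - P.decMean (P.encMean x + √P.latentVar • ξ)‖ ^ 2)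
        ∂(stdGaussian (EuclideanSpace ℝ (Fin dz))) := by
    refine Measurable.lintegral_prod_right' (f := fun p : _ × _ ↦
      ENNReal.ofReal (‖p.1 - P.decMean (P.encMean p.1 + √P.latentVar • p.2)‖ ^ 2)) ?_
    fun_prop
  simp_rw [objective, hrec, hkl]
  rw [lintegral_add_left (hm.const_mul _), lintegral_const_mul _ hm, reconError,
    ← ofReal_integral_eq_lintegral_ofReal]
  · congr 2
    rw [integral_div, integral_sub, integral_sub, integral_add, meanKL]
    · simp
    all_goals fun_prop
  · fun_prop
  · exact ae_of_all _ fun x ↦ gaussian_kl_nonneg dz (by positivity) hs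

omit [IsProbabilityMeasure pdata] in
theorem Admissible.meanKL_nonneg (hP : P.Admissible L) : 0 ≤ P.meanKL pdata :=
  gaussian_kl_nonneg dz (integral_nonneg fun _ ↦ by positivity) hP.latentVar_pos

end VAEParams

/-! ### Bias-variance decomposition and its stability under truncation. -/

section SecondMoments

variable {Ω E : Type*} [MeasurableSpace Ω] [NormedAddCommGroup E] [InnerProductSpace ℝ E]
  [CompleteSpace E] {μ : Measure Ω}

omit [InnerProductSpace ℝ E] [CompleteSpace E] in
theorem lintegral_ofReal_norm_sq_eq {F : Ω → E} (hF : MemLp F 2 μ) :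
    ∫⁻ ω, ENNReal.ofReal (‖F ω‖ ^ 2) ∂μ = ENNReal.ofReal (∫ ω, ‖F ω‖ ^ 2 ∂μ) :=
  (ofReal_integral_eq_lintegral_ofReal (hF.integrable_norm_pow (by norm_num))
    (ae_of_all _ fun _ ↦ by positivity)).symm

omit [InnerProductSpace ℝ E] [CompleteSpace E] in
theorem memLp_two_of_lintegral_ofReal_norm_sq_ne_top {F : Ω → E} (hF : AEStronglyMeasurable F μ)
    (h : ∫⁻ ω, ENNReal.ofReal (‖F ω‖ ^ 2) ∂μ ≠ ∞) : MemLp F 2 μ := by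
  rw [memLp_two_iff_integrable_sq_norm hF]
  refine ⟨by fun_prop, ?_⟩
  rw [hasFiniteIntegral_iff_ofReal (ae_of_all _ fun _ ↦ by positivity)]
  exact h.lt_top

variable [IsProbabilityMeasure μ]

theorem integral_norm_sub_sq_eq_add {F : Ω → E} (hF : MemLp F 2 μ) (a : E) :
    ∫ ω, ‖F ω - a‖ ^ 2 ∂μ
      = ∫ ω, ‖F ω - ∫ ω', F ω' ∂μ‖ ^ 2 ∂μ + ‖a - ∫ ω', F ω' ∂μ‖ ^ 2 := by
  set m := ∫ ω', F ω' ∂μ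
  have hc : MemLp (fun ω ↦ F ω - m) 2 μ := hF.sub (memLp_const _)
  have h : ∀ ω, ‖F ω - a‖ ^ 2
      = ‖F ω - m‖ ^ 2 - 2 * inner ℝ (a - m) (F ω - m) + ‖a - m‖ ^ 2 := by
    intro ω
    rw [show F ω - a = (F ω - m) - (a - m) by abel, norm_sub_sq_real, real_inner_comm]
  have hi : Integrable (fun ω ↦ F ω - m) μ := hc.integrable (by norm_num)
  have h1 : Integrable (fun ω ↦ ‖F ω - m‖ ^ 2) μ := hc.integrable_norm_pow (by norm_num)
  have h2 : Integrable (fun ω ↦ 2 * inner ℝ (a - m) (F ω - m)) μ := (hi.const_inner _).const_mul _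
  have h0 : ∫ ω, (F ω - m) ∂μ = 0 := by
    rw [integral_sub (hF.integrable (by norm_num)) (integrable_const _)]
    simp [m]
  simp_rw [h]
  rw [integral_add (by exact h1.sub h2) (integrable_const _), integral_sub h1 h2, integral_const_mul,
    integral_inner hi, h0]
  simp

theorem lintegral_norm_sub_sq_eq_add {F : Ω → E} (hF : AEStronglyMeasurable F μ) (a : E)
    (h : ∫⁻ ω, ENNReal.ofReal (‖a - F ω‖ ^ 2) ∂μ ≠ ∞) :
    ∫⁻ ω, ENNReal.ofReal (‖a - F ω‖ ^ 2) ∂μ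
      = ENNReal.ofReal (‖a - ∫ ω', F ω' ∂μ‖ ^ 2)
        + ∫⁻ ω, ENNReal.ofReal (‖F ω - ∫ ω', F ω' ∂μ‖ ^ 2) ∂μ := by
  have h1 : MemLp (fun ω ↦ a - F ω) 2 μ :=
    memLp_two_of_lintegral_ofReal_norm_sq_ne_top (aestronglyMeasurable_const.sub hF) h
  have h2 : MemLp F 2 μ :=
    ((memLp_const a).sub h1).ae_eq (ae_of_all _ fun ω ↦ by simp)
  rw [lintegral_ofReal_norm_sq_eq h1, lintegral_ofReal_norm_sq_eq (F := fun ω ↦ F ω - ∫ ω', F ω' ∂μ)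
      (h2.sub (memLp_const _)),
    ← ENNReal.ofReal_add (by positivity) (integral_nonneg fun _ ↦ by positivity)]
  congr 1
  simp_rw [norm_sub_rev a (F _)]
  rw [integral_norm_sub_sq_eq_add h2, add_comm]

/-- Restricting to an event of almost full probability barely decreases the mean squared distance
to any point, compared with the total variance. -/
theorem exists_forall_variance_le_setIntegral_add {F : Ω → E} (hF : MemLp F 2 μ) {η : ℝ}
    (hη : 0 < η) :
    ∃ τ : ℝ, 0 < τ ∧ ∀ D : Set Ω, MeasurableSet D → μ Dᶜ ≤ ENNReal.ofReal τ → ∀ a : E,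
      ∫ ω, ‖F ω - ∫ ω', F ω' ∂μ‖ ^ 2 ∂μ ≤ ∫ ω in D, ‖F ω - a‖ ^ 2 ∂μ + η := by
  set m := ∫ ω', F ω' ∂μ
  have hc : MemLp (fun ω ↦ F ω - m) 2 μ := hF.sub (memLp_const _)
  have hi : Integrable (fun ω ↦ ‖F ω - m‖ ^ 2) μ := hc.integrable_norm_pow (by norm_num)
  obtain ⟨τ, hτ, H⟩ := (memLp_one_iff_integrable.2 hi).eLpNorm_indicator_le le_rfl (by norm_num)
    (half_pos hη)
  -- The cap `1 / 2` bounds the loss `2 ‖a - m‖² μ(Dᶜ)` by the bias `‖a - m‖²`, which the full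
  -- integral contains anyway. This makes `τ` independent of `a`.
  refine ⟨min τ (1 / 2), by positivity, fun D hD hμD a ↦ ?_⟩
  have hDc := hD.compl
  have h1 := H Dᶜ hDc (hμD.trans (ENNReal.ofReal_le_ofReal (min_le_left _ _)))
  have h2 : μ.real Dᶜ ≤ 1 / 2 :=
    ENNReal.toReal_le_of_le_ofReal (by norm_num)
      (hμD.trans (ENNReal.ofReal_le_ofReal (min_le_right _ _)))
  have hia : Integrable (fun ω ↦ ‖F ω - a‖ ^ 2) μ :=
    (hF.sub (memLp_const a)).integrable_norm_pow (by norm_num)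
  have h3 : ∫ ω in Dᶜ, ‖F ω - m‖ ^ 2 ∂μ ≤ η / 2 := by
    rw [eLpNorm_indicator_eq_eLpNorm_restrict hDc, eLpNorm_one_eq_lintegral_enorm,
      ← ofReal_integral_norm_eq_lintegral_enorm hi.integrableOn,
      ENNReal.ofReal_le_ofReal_iff (by positivity)] at h1
    simpa using h1
  have h5 : ∫ ω in Dᶜ, ‖F ω - a‖ ^ 2 ∂μ ≤ η + ‖a - m‖ ^ 2 := by
    calc ∫ ω in Dᶜ, ‖F ω - a‖ ^ 2 ∂μ
        ≤ ∫ ω in Dᶜ, (2 * ‖F ω - m‖ ^ 2 + 2 * ‖a - m‖ ^ 2) ∂μ := by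
          refine integral_mono hia.integrableOn
            ((hi.integrableOn.const_mul _).add (integrable_const _)) fun ω ↦ ?_
          have := norm_sub_le (F ω - m) (a - m)
          rw [sub_sub_sub_cancel_right] at this
          have h6 := norm_nonneg (F ω - a)
          nlinarith [sq_nonneg (‖F ω - m‖ - ‖a - m‖)]
      _ = 2 * ∫ ω in Dᶜ, ‖F ω - m‖ ^ 2 ∂μ + μ.real Dᶜ * (2 * ‖a - m‖ ^ 2) := by
          rw [integral_add (hi.integrableOn.const_mul _) (integrable_const _), integral_const_mul]
          simp
      _ ≤ η + ‖a - m‖ ^ 2 := by nlinarith [sq_nonneg ‖a - m‖]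
  have h7 := integral_norm_sub_sq_eq_add hF a
  have h8 := integral_add_compl hD hia
  linarith

end SecondMoments

/-! ### Uniform lower bounds for shifted Gaussians, and a Young inequality. -/

section StdGaussian

variable {V : Type*} [NormedAddCommGroup V] [InnerProductSpace ℝ V] [FiniteDimensional ℝ V]
  [MeasurableSpace V] [BorelSpace V]

omit [FiniteDimensional ℝ V] [MeasurableSpace V] [BorelSpace V] in
-- The point is uniformity: one weight in `w` works for all centers in the ball and all variances in
-- `[ε / 2, 1]`. The `log s` term has a favorable sign because `s ≤ 1`.
theorem exp_neg_le_gaussianRatio {m : V} {s ε M : ℝ} (hε : 0 < ε) (hs : ε ≤ 2 * s) (hs1 : s ≤ 1)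
    (hm : ‖m‖ ≤ 2 * M) (w : V) :
    Real.exp (-((‖w‖ + 2 * M) ^ 2 / ε)) ≤ gaussianRatio m s w := by
  have hs0 : 0 < s := by linarith
  rw [gaussianRatio, Real.exp_le_exp]
  have h1 : Module.finrank ℝ V / 2 * Real.log s ≤ 0 :=
    mul_nonpos_of_nonneg_of_nonpos (by positivity) (Real.log_nonpos hs0.le hs1)
  have h2 : ‖w - m‖ ^ 2 / (2 * s) ≤ (‖w‖ + 2 * M) ^ 2 / ε := by
    gcongr
    exact (norm_sub_le w m).trans (by gcongr)
  have h3 : 0 ≤ ‖w‖ ^ 2 / 2 := by positivity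
  linarith

theorem lintegral_stdGaussian_exp_neg_pos (M ε : ℝ) :
    0 < ∫⁻ w : V, ENNReal.ofReal (Real.exp (-((‖w‖ + 2 * M) ^ 2 / ε))) ∂(stdGaussian V) := by
  rw [lintegral_pos_iff_support (by fun_prop)]
  have : (Function.support fun w : V ↦ ENNReal.ofReal (Real.exp (-((‖w‖ + 2 * M) ^ 2 / ε))))
      = Set.univ := by
    ext w
    simp [Real.exp_pos]
  rw [this]
  simp

end StdGaussian

/-- Young's inequality for the cross term. The main term keeps a factor close to 1, so that the
strict inequality `r < V` survives. -/
theorem ofReal_norm_sub_sq_le {E : Type*} [NormedAddCommGroup E] (x a b : E) {η : ℝ}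
    (hη : 0 < η) :
    ENNReal.ofReal (‖x - a‖ ^ 2) ≤ ENNReal.ofReal (1 + η) * ENNReal.ofReal (‖x - b‖ ^ 2)
      + ENNReal.ofReal (1 + η⁻¹) * ENNReal.ofReal (‖a - b‖ ^ 2) := by
  rw [← ENNReal.ofReal_mul (by positivity), ← ENNReal.ofReal_mul (by positivity),
    ← ENNReal.ofReal_add (by positivity) (by positivity)]
  refine ENNReal.ofReal_le_ofReal ?_
  have h : ‖x - a‖ ≤ ‖x - b‖ + ‖a - b‖ := by
    simpa using norm_sub_le (x - b) (a - b)
  have h1 : ‖x - a‖ ^ 2 ≤ (‖x - b‖ + ‖a - b‖) ^ 2 := by gcongr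
  have h2 : 0 ≤ (η * ‖x - b‖ - ‖a - b‖) ^ 2 / η := by positivity
  have h3 : (η * ‖x - b‖ - ‖a - b‖) ^ 2 / η
      = η * ‖x - b‖ ^ 2 - 2 * ‖x - b‖ * ‖a - b‖ + η⁻¹ * ‖a - b‖ ^ 2 := by
    field_simp
    ring
  linarith

/-! ### Averaging out half of the latent noise. -/

namespace VAEParams

variable {dx dz : ℕ}

/-- The parameters with half the latent variance, where the decoder absorbs the other half of the
noise by averaging over it. -/
noncomputable def halve (P : VAEParams dx dz) : VAEParams dx dz where
  decMean y := ∫ b, P.decMean (y + √(P.latentVar / 2) • b)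
    ∂(stdGaussian (EuclideanSpace ℝ (Fin dz)))
  encMean := P.encMean
  latentVar := P.latentVar / 2

/-- The mean variance of the decoder over the half of the noise averaged out in `halve`. -/
noncomputable def smoothingGap (pdata : Measure (EuclideanSpace ℝ (Fin dx)))
    (P : VAEParams dx dz) : ℝ≥0∞ :=
  ∫⁻ x, ∫⁻ a, ∫⁻ b, ENNReal.ofReal
    (‖P.decMean (P.encMean x + √(P.latentVar / 2) • a + √(P.latentVar / 2) • b)
      - P.halve.decMean (P.encMean x + √(P.latentVar / 2) • a)‖ ^ 2)
    ∂(stdGaussian (EuclideanSpace ℝ (Fin dz))) ∂(stdGaussian (EuclideanSpace ℝ (Fin dz))) ∂pdata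

variable {pdata : Measure (EuclideanSpace ℝ (Fin dx))} [IsProbabilityMeasure pdata]
  {L : ℝ≥0∞} {P : VAEParams dx dz}

omit [IsProbabilityMeasure pdata] in
theorem Admissible.halve (hP : P.Admissible L) : P.halve.Admissible L where
  measurable_decMean := by
    have hf := hP.measurable_decMean
    refine StronglyMeasurable.measurable ?_
    refine StronglyMeasurable.integral_prod_right' (f := fun p : _ × _ ↦
      P.decMean (p.1 + √(P.latentVar / 2) • p.2)) ?_
    exact (hf.comp (by fun_prop)).stronglyMeasurable
  lipschitz_encMean := hP.lipschitz_encMean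
  latentVar_pos := half_pos hP.latentVar_pos

omit [IsProbabilityMeasure pdata] in
-- Given `x` and the retained noise `a`, the halved decoder is the conditional mean of the original
-- one, so this is the bias-variance identity in `b`, integrated over `a` and `x`.
theorem reconError_eq_add_smoothingGap (hP : P.Admissible L) (hR : P.reconError pdata ≠ ∞) :
    P.reconError pdata = P.halve.reconError pdata + P.smoothingGap pdata := by
  have hs := hP.latentVar_pos
  have hf := hP.measurable_decMean
  have hμ := hP.continuous_encMean.measurable
  have hg := hP.halve.measurable_decMean
  set σ := √(P.latentVar / 2) with hσ
  set g := P.halve.decMean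
  set γ := stdGaussian (EuclideanSpace ℝ (Fin dz))
  have h1 : P.reconError pdata = ∫⁻ x, ∫⁻ a, ∫⁻ b,
      ENNReal.ofReal (‖x - P.decMean (P.encMean x + σ • a + σ • b)‖ ^ 2) ∂γ ∂γ ∂pdata := by
    refine lintegral_congr fun x ↦ ?_
    rw [lintegral_stdGaussian_sqrt_smul hs.le
      (h := fun z ↦ ENNReal.ofReal (‖x - P.decMean (P.encMean x + z)‖ ^ 2)) (by fun_prop)]
    simp_rw [← add_assoc]
    rfl
  have hm3 : Measurable fun p : (EuclideanSpace ℝ (Fin dx) × EuclideanSpace ℝ (Fin dz))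
      × EuclideanSpace ℝ (Fin dz) ↦
      ENNReal.ofReal (‖p.1.1 - P.decMean (P.encMean p.1.1 + σ • p.1.2 + σ • p.2)‖ ^ 2) := by
    fun_prop
  have hm2 := hm3.lintegral_prod_right' (ν := γ)
  have hm1 := hm2.lintegral_prod_right' (ν := γ)
  have hfin : ∀ᵐ x ∂pdata, ∀ᵐ a ∂γ, ∫⁻ b,
      ENNReal.ofReal (‖x - P.decMean (P.encMean x + σ • a + σ • b)‖ ^ 2) ∂γ ≠ ∞ := by
    rw [h1] at hR
    filter_upwards [ae_lt_top hm1 hR] with x hx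
    filter_upwards [ae_lt_top (hm2.comp measurable_prodMk_left) hx.ne] with a ha
    exact ha.ne
  have h2 : P.reconError pdata = ∫⁻ x, ∫⁻ a,
      (ENNReal.ofReal (‖x - g (P.encMean x + σ • a)‖ ^ 2)
      + ∫⁻ b, ENNReal.ofReal (‖P.decMean (P.encMean x + σ • a + σ • b)
        - g (P.encMean x + σ • a)‖ ^ 2) ∂γ) ∂γ ∂pdata := by
    rw [h1]
    refine lintegral_congr_ae ?_
    filter_upwards [hfin] with x hx
    refine lintegral_congr_ae ?_
    filter_upwards [hx] with a ha
    exact lintegral_norm_sub_sq_eq_add (hf.comp (by fun_prop)).aestronglyMeasurable x ha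
  rw [h2, reconError, smoothingGap, ← lintegral_add_left]
  · refine lintegral_congr fun x ↦ ?_
    rw [lintegral_add_left (by fun_prop)]
    rfl
  · refine Measurable.lintegral_prod_right' (f := fun p : _ × _ ↦
      ENNReal.ofReal (‖p.1 - g (P.halve.encMean p.1 + √P.halve.latentVar • p.2)‖ ^ 2))
      ?_
    have : Measurable P.halve.encMean := hμ
    change Measurable fun p : _ × _ ↦
      ENNReal.ofReal (‖p.1 - g (P.halve.encMean p.1 + √P.halve.latentVar • p.2)‖ ^ 2)
    fun_prop

/-- Every center `Y p` from the truncated region has a noise law dominating the same weight `k`.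
Exchanging integrals bounds the `k`-weighted integral of `H` by the gap, so some `w` has `H w` at
most the weighted average; `c` is the decoder value there. -/
theorem exists_setLIntegral_mul_le_smoothingGap (hP : P.Admissible L) {ε : ℝ} (hε : 0 < ε)
    (hεs : ε ≤ P.latentVar) (hs2 : P.latentVar ≤ 2) (M : ℝ) :
    ∃ c, (∫⁻ x in {x | ‖P.encMean x‖ ≤ M}, ∫⁻ a in {a | ‖a‖ ≤ M},
        ENNReal.ofReal (‖c - P.halve.decMean (P.encMean x + √(P.latentVar / 2) • a)‖ ^ 2)
          ∂(stdGaussian (EuclideanSpace ℝ (Fin dz))) ∂pdata)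
      ≤ P.smoothingGap pdata / ∫⁻ w : EuclideanSpace ℝ (Fin dz),
          ENNReal.ofReal (Real.exp (-((‖w‖ + 2 * M) ^ 2 / ε))) ∂(stdGaussian _) := by
  have hf := hP.measurable_decMean
  have hμ := hP.continuous_encMean.measurable
  have hg := hP.halve.measurable_decMean
  set σ := √(P.latentVar / 2) with hσ
  set g := P.halve.decMean
  set γ := stdGaussian (EuclideanSpace ℝ (Fin dz))
  set D := {x | ‖P.encMean x‖ ≤ M}
  set B := {a : EuclideanSpace ℝ (Fin dz) | ‖a‖ ≤ M}
  have hD : MeasurableSet D := measurableSet_le (by fun_prop) (by fun_prop)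
  have hB : MeasurableSet B := measurableSet_le (by fun_prop) (by fun_prop)
  set k : EuclideanSpace ℝ (Fin dz) → ℝ≥0∞ :=
    fun w ↦ ENNReal.ofReal (Real.exp (-((‖w‖ + 2 * M) ^ 2 / ε)))
  have hk : Measurable k := by fun_prop
  set ν := (pdata.restrict D).prod (γ.restrict B)
  set Y : EuclideanSpace ℝ (Fin dx) × EuclideanSpace ℝ (Fin dz) → EuclideanSpace ℝ (Fin dz) :=
    fun p ↦ P.encMean p.1 + σ • p.2
  have hY : Measurable Y := by fun_prop
  set H : EuclideanSpace ℝ (Fin dz) → ℝ≥0∞ :=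
    fun w ↦ ∫⁻ p, ENNReal.ofReal (‖P.decMean w - g (Y p)‖ ^ 2) ∂ν
  have hH : Measurable H := by
    refine Measurable.lintegral_prod_right' (f := fun q : _ × _ ↦
      ENNReal.ofReal (‖P.decMean q.1 - g (Y q.2)‖ ^ 2)) ?_
    fun_prop
  have hν : ∀ᵐ p ∂ν, p ∈ D ×ˢ B := by
    simp only [ν, Measure.prod_restrict]
    exact ae_restrict_mem (hD.prod hB)
  have hYM : ∀ p ∈ D ×ˢ B, ‖Y p‖ ≤ 2 * M := by
    rintro ⟨x, a⟩ ⟨hx, ha⟩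
    have hσ1 : σ ≤ 1 := by rw [hσ, Real.sqrt_le_one]; linarith
    have : ‖σ • a‖ ≤ 1 * M := by
      rw [norm_smul, Real.norm_eq_abs, abs_of_nonneg (Real.sqrt_nonneg _)]
      exact mul_le_mul hσ1 ha (norm_nonneg _) zero_le_one
    calc ‖P.encMean x + σ • a‖ ≤ ‖P.encMean x‖ + ‖σ • a‖ := norm_add_le _ _
      _ ≤ M + 1 * M := add_le_add hx this
      _ = 2 * M := by ring
  have hkey : ∫⁻ w, k w * H w ∂γ ≤ P.smoothingGap pdata := by
    calc ∫⁻ w, k w * H w ∂γ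
        = ∫⁻ w, ∫⁻ p, k w * ENNReal.ofReal (‖P.decMean w - g (Y p)‖ ^ 2) ∂ν ∂γ := by
          refine lintegral_congr fun w ↦ ?_
          rw [lintegral_const_mul _ (by fun_prop)]
      _ = ∫⁻ p, ∫⁻ w, k w * ENNReal.ofReal (‖P.decMean w - g (Y p)‖ ^ 2) ∂γ ∂ν := by
          refine lintegral_lintegral_swap (Measurable.aemeasurable ?_)
          simp only [Function.uncurry_def]
          fun_prop
      _ ≤ ∫⁻ p, ∫⁻ b, ENNReal.ofReal
            (‖P.decMean (Y p + σ • b) - g (Y p)‖ ^ 2) ∂γ ∂ν := by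
          refine lintegral_mono_ae ?_
          filter_upwards [hν] with p hp
          have h1 := lintegral_map
            (f := fun z ↦ ENNReal.ofReal (‖P.decMean z - g (Y p)‖ ^ 2))
            (g := fun ξ ↦ Y p + σ • ξ) (μ := γ) (by fun_prop) (by fun_prop)
          rw [← h1, map_stdGaussian_eq_withDensity _ (half_pos hP.latentVar_pos),
            lintegral_withDensity_eq_lintegral_mul _ (by fun_prop) (by fun_prop)]
          refine lintegral_mono fun w ↦ ?_
          simp only [Pi.mul_apply]
          gcongr
          exact ENNReal.ofReal_le_ofReal
            (exp_neg_le_gaussianRatio hε (by linarith) (by linarith) (hYM p hp) w)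
      _ ≤ ∫⁻ p, ∫⁻ b, ENNReal.ofReal
            (‖P.decMean (Y p + σ • b) - g (Y p)‖ ^ 2) ∂γ ∂(pdata.prod γ) := by
          refine lintegral_mono' ?_ le_rfl
          simp only [ν, Measure.prod_restrict]
          exact Measure.restrict_le_self
      _ = P.smoothingGap pdata := by
          rw [lintegral_prod]
          · rfl
          · refine (Measurable.lintegral_prod_right' (f := fun q : _ × _ ↦ ENNReal.ofReal
              (‖P.decMean (Y q.1 + σ • q.2) - g (Y q.1)‖ ^ 2)) ?_).aemeasurable
            fun_prop
  have hne : γ.withDensity k ≠ 0 := by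
    intro h
    have h1 : γ.withDensity k Set.univ = 0 := by simp [h]
    rw [withDensity_apply _ MeasurableSet.univ, Measure.restrict_univ] at h1
    exact (lintegral_stdGaussian_exp_neg_pos M ε).ne' h1
  have : IsFiniteMeasure (γ.withDensity k) := by
    refine isFiniteMeasure_withDensity (ne_top_of_le_ne_top ENNReal.one_ne_top ?_)
    calc ∫⁻ w, k w ∂γ ≤ ∫⁻ _, 1 ∂γ := lintegral_mono fun w ↦ by
          refine ENNReal.ofReal_le_one.2 (Real.exp_le_one_iff.2 (neg_nonpos.2 ?_))
          positivity
      _ = 1 := by simp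
  obtain ⟨w, hw⟩ := exists_le_laverage hne hH.aemeasurable
  refine ⟨P.decMean w, ?_⟩
  rw [laverage_eq, lintegral_withDensity_eq_lintegral_mul _ hk hH,
    withDensity_apply _ MeasurableSet.univ, Measure.restrict_univ] at hw
  have h2 : H w = ∫⁻ x in D, ∫⁻ a in B, ENNReal.ofReal
      (‖P.decMean w - g (P.encMean x + σ • a)‖ ^ 2) ∂γ ∂pdata := by
    simp only [H, ν]
    rw [lintegral_prod _ (by fun_prop)]
  rw [← h2]
  refine hw.trans ?_
  gcongr
  exact hkey

/-- Compares `x` with `c` through the averaged decoder. The Gaussian mass of the ball appears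
because `‖x - c‖²` does not depend on the noise being integrated. -/
theorem exists_measure_mul_setLIntegral_le (hP : P.Admissible L) {ε : ℝ} (hε : 0 < ε)
    (hεs : ε ≤ P.latentVar) (hs2 : P.latentVar ≤ 2) (M : ℝ) {η : ℝ} (hη : 0 < η) :
    ∃ c, stdGaussian (EuclideanSpace ℝ (Fin dz)) {a | ‖a‖ ≤ M}
        * ∫⁻ x in {x | ‖P.encMean x‖ ≤ M}, ENNReal.ofReal (‖x - c‖ ^ 2) ∂pdata
      ≤ ENNReal.ofReal (1 + η) * P.halve.reconError pdata
        + ENNReal.ofReal (1 + η⁻¹) * (P.smoothingGap pdata / ∫⁻ w : EuclideanSpace ℝ (Fin dz),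
          ENNReal.ofReal (Real.exp (-((‖w‖ + 2 * M) ^ 2 / ε))) ∂(stdGaussian _)) := by
  have hμ := hP.continuous_encMean.measurable
  have hg := hP.halve.measurable_decMean
  obtain ⟨c, hc⟩ := exists_setLIntegral_mul_le_smoothingGap (pdata := pdata) hP hε hεs hs2 M
  refine ⟨c, ?_⟩
  set σ := √(P.latentVar / 2) with hσ
  set γ := stdGaussian (EuclideanSpace ℝ (Fin dz))
  set D := {x | ‖P.encMean x‖ ≤ M}
  set B := {a : EuclideanSpace ℝ (Fin dz) | ‖a‖ ≤ M}
  set g := P.halve.decMean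
  have hm1 : Measurable fun x ↦ ∫⁻ a in B,
      ENNReal.ofReal (‖x - g (P.encMean x + σ • a)‖ ^ 2) ∂γ := by
    refine Measurable.lintegral_prod_right' (f := fun p : _ × _ ↦
      ENNReal.ofReal (‖p.1 - g (P.encMean p.1 + σ • p.2)‖ ^ 2)) ?_
    fun_prop
  have hm2 : Measurable fun x ↦ ∫⁻ a in B,
      ENNReal.ofReal (‖c - g (P.encMean x + σ • a)‖ ^ 2) ∂γ := by
    refine Measurable.lintegral_prod_right' (f := fun p : _ × _ ↦
      ENNReal.ofReal (‖c - g (P.encMean p.1 + σ • p.2)‖ ^ 2)) ?_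
    fun_prop
  calc γ B * ∫⁻ x in D, ENNReal.ofReal (‖x - c‖ ^ 2) ∂pdata
      = ∫⁻ x in D, ∫⁻ _ in B, ENNReal.ofReal (‖x - c‖ ^ 2) ∂γ ∂pdata := by
        rw [← lintegral_const_mul _ (by fun_prop)]
        refine lintegral_congr fun x ↦ ?_
        rw [setLIntegral_const, mul_comm]
    _ ≤ ∫⁻ x in D, ∫⁻ a in B, (ENNReal.ofReal (1 + η)
            * ENNReal.ofReal (‖x - g (P.encMean x + σ • a)‖ ^ 2)
          + ENNReal.ofReal (1 + η⁻¹)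
            * ENNReal.ofReal (‖c - g (P.encMean x + σ • a)‖ ^ 2)) ∂γ ∂pdata :=
        lintegral_mono fun x ↦ lintegral_mono fun a ↦ ofReal_norm_sub_sq_le _ _ _ hη
    _ = ENNReal.ofReal (1 + η) * ∫⁻ x in D, ∫⁻ a in B,
            ENNReal.ofReal (‖x - g (P.encMean x + σ • a)‖ ^ 2) ∂γ ∂pdata
          + ENNReal.ofReal (1 + η⁻¹) * ∫⁻ x in D, ∫⁻ a in B,
            ENNReal.ofReal (‖c - g (P.encMean x + σ • a)‖ ^ 2) ∂γ ∂pdata := by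
        rw [← lintegral_const_mul _ hm1, ← lintegral_const_mul _ hm2, ← lintegral_add_left
          (hm1.const_mul _)]
        refine lintegral_congr fun x ↦ ?_
        rw [lintegral_add_left (by fun_prop), lintegral_const_mul _ (by fun_prop),
          lintegral_const_mul _ (by fun_prop)]
    _ ≤ _ := by
        gcongr
        exact (setLIntegral_le_lintegral _ _).trans
          (lintegral_mono fun x ↦ setLIntegral_le_lintegral _ _)

end VAEParams

/-! ### Chebyshev's inequality and comparison of an optimum with competitors. -/

theorem measure_compl_norm_le_le_of_integral_sq_le {Ω E : Type*} [MeasurableSpace Ω]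
    [NormedAddCommGroup E] {μ : Measure Ω} [IsProbabilityMeasure μ] {F : Ω → E}
    (hF : Integrable (fun ω ↦ ‖F ω‖ ^ 2) μ) {C M : ℝ} (hM : 0 < M)
    (hC : ∫ ω, ‖F ω‖ ^ 2 ∂μ ≤ C) :
    μ {ω | ‖F ω‖ ≤ M}ᶜ ≤ ENNReal.ofReal (C / M ^ 2) := by
  have h1 := mul_meas_ge_le_integral_of_nonneg (ae_of_all _ fun ω ↦ by positivity) hF (M ^ 2)
  have h2 : μ.real {ω | ‖F ω‖ ≤ M}ᶜ ≤ μ.real {ω | M ^ 2 ≤ ‖F ω‖ ^ 2} := by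
    refine measureReal_mono fun ω hω ↦ ?_
    simp only [Set.mem_compl_iff, Set.mem_ofPred_eq, not_le] at hω ⊢
    gcongr
  have h3 : μ.real {ω | ‖F ω‖ ≤ M}ᶜ ≤ C / M ^ 2 := by
    rw [le_div_iff₀ (by positivity)]
    nlinarith [sq_nonneg M]
  rw [← ofReal_measureReal]
  exact ENNReal.ofReal_le_ofReal h3

namespace VAEParams

variable {dx dz : ℕ}

/-- The parameters with latents shrunk by the factor `1 / 2`. -/
noncomputable def shrink (P : VAEParams dx dz) : VAEParams dx dz where
  decMean z := P.decMean ((2 : ℝ) • z)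
  encMean x := (1 / 2 : ℝ) • P.encMean x
  latentVar := P.latentVar / 4

variable {pdata : Measure (EuclideanSpace ℝ (Fin dx))} {L : ℝ≥0∞} {P Q : VAEParams dx dz} {v : ℝ}

theorem Admissible.shrink (hP : P.Admissible L) : P.shrink.Admissible L where
  measurable_decMean := hP.measurable_decMean.comp (by fun_prop)
  lipschitz_encMean := by
    obtain ⟨K, hKL, hK⟩ := hP.lipschitz_encMean
    refine ⟨K, hKL, LipschitzWith.of_dist_le_mul fun x y ↦ ?_⟩
    have h := hK.dist_le_mul x y
    have h0 := dist_nonneg (x := P.encMean x) (y := P.encMean y)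
    simp only [VAEParams.shrink, dist_smul₀, Real.norm_eq_abs]
    rw [abs_of_pos (by norm_num)]
    linarith
  latentVar_pos := div_pos hP.latentVar_pos (by norm_num)

theorem reconError_shrink (P : VAEParams dx dz) :
    P.shrink.reconError pdata = P.reconError pdata := by
  refine lintegral_congr fun x ↦ lintegral_congr fun ξ ↦ ?_
  have h : √(P.latentVar / 4) = √P.latentVar / 2 := by
    rw [Real.sqrt_div' _ (by norm_num), show (4 : ℝ) = 2 ^ 2 by norm_num,
      Real.sqrt_sq (by norm_num)]
  simp only [shrink, h, smul_add, smul_smul]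
  congr 6
  · rw [show (2 : ℝ) * (1 / 2) = 1 by norm_num, one_smul]
  · congr 1
    ring

variable [IsProbabilityMeasure pdata]

theorem IsGlobalOptimum.reconError_ne_top (hP : P.IsGlobalOptimum pdata L v)
    (hcov : MemLp id 2 pdata) (hv : 0 < v) (hQ : Q.Admissible L) (hR : Q.reconError pdata ≠ ∞) :
    P.reconError pdata ≠ ∞ := by
  have h := hP.2 Q hQ
  rw [objective_eq hP.1 hcov, objective_eq hQ hcov] at h
  intro htop
  rw [htop, ENNReal.mul_top (by simpa using hv), top_add, top_le_iff] at h
  exact ENNReal.add_ne_top.2 ⟨ENNReal.mul_ne_top ENNReal.ofReal_ne_top hR,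
    ENNReal.ofReal_ne_top⟩ h

/-- Rescaling by `2v` puts the small factor on the KL terms, the form in which `v → 0` is exploited.
-/
theorem IsGlobalOptimum.toReal_le (hP : P.IsGlobalOptimum pdata L v)
    (hcov : MemLp id 2 pdata) (hv : 0 < v) (hQ : Q.Admissible L) (hR : Q.reconError pdata ≠ ∞) :
    (P.reconError pdata).toReal + 2 * v * P.meanKL pdata
      ≤ (Q.reconError pdata).toReal + 2 * v * Q.meanKL pdata := by
  have hPR := hP.reconError_ne_top hcov hv hQ hR
  have h := hP.2 Q hQ
  rw [objective_eq hP.1 hcov, objective_eq hQ hcov] at h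
  have hv' : 0 ≤ 1 / (2 * v) := by positivity
  rw [← ENNReal.ofReal_toReal hPR, ← ENNReal.ofReal_toReal hR, ← ENNReal.ofReal_mul hv',
    ← ENNReal.ofReal_mul hv', ← ENNReal.ofReal_add (by positivity) hP.1.meanKL_nonneg,
    ← ENNReal.ofReal_add (by positivity) hQ.meanKL_nonneg,
    ENNReal.ofReal_le_ofReal_iff (add_nonneg (by positivity) hQ.meanKL_nonneg)] at h
  have h2 := mul_le_mul_of_nonneg_left h (show 0 ≤ 2 * v by positivity)
  have h3 : ∀ r k : ℝ, 2 * v * (1 / (2 * v) * r + k) = r + 2 * v * k := by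
    intro r k
    field_simp
  rwa [h3, h3] at h2

/-- At an optimum, shrinking the latents does not pay off, which bounds their second moment. -/
theorem IsGlobalOptimum.second_moment_le (hP : P.IsGlobalOptimum pdata L v)
    (hcov : MemLp id 2 pdata) (hv : 0 < v) (hR : P.reconError pdata ≠ ∞) :
    dz * P.latentVar + ∫ x, ‖P.encMean x‖ ^ 2 ∂pdata ≤ 2 * dz := by
  have h := hP.toReal_le hcov hv hP.1.shrink (by rwa [reconError_shrink])
  rw [reconError_shrink] at h
  have h1 : P.meanKL pdata ≤ P.shrink.meanKL pdata :=
    le_of_mul_le_mul_left (le_of_add_le_add_left h) (by positivity)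
  have hI : ∫ x, ‖P.shrink.encMean x‖ ^ 2 ∂pdata = 1 / 4 * ∫ x, ‖P.encMean x‖ ^ 2 ∂pdata := by
    rw [← integral_const_mul]
    refine integral_congr_ae (ae_of_all _ fun x ↦ ?_)
    simp only [shrink, norm_smul, mul_pow]
    norm_num
  have hlog : Real.log P.shrink.latentVar = Real.log P.latentVar - 2 * Real.log 2 := by
    simp only [shrink]
    rw [Real.log_div hP.1.latentVar_pos.ne' (by norm_num), show (4 : ℝ) = 2 ^ 2 by norm_num,
      Real.log_pow]
    norm_num
  rw [meanKL, meanKL, hI, hlog] at h1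
  simp only [shrink] at h1
  -- The comparison reads `(3/4) · (second moment) ≤ 2 dz log 2`; the bound `log 2 ≤ 3/4` turns this
  -- into exactly `2 dz`.
  have h2 : (dz : ℝ) * Real.log 2 ≤ dz * (3 / 4) := by
    gcongr
    linarith [Real.log_two_lt_d9]
  linarith

/-! ### A competitor with error below the data variance. -/

theorem integral_norm_sub_sq_pos_of_ne_dirac
    (hcov : MemLp id 2 pdata) {a : EuclideanSpace ℝ (Fin dx)} (ha : pdata ≠ Measure.dirac a) :
    0 < ∫ x, ‖x - a‖ ^ 2 ∂pdata := by
  refine lt_of_le_of_ne (integral_nonneg fun _ ↦ by positivity) fun h ↦ ha ?_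
  have hi : Integrable (fun x ↦ ‖x - a‖ ^ 2) pdata :=
    (hcov.sub (memLp_const a)).integrable_norm_pow (by norm_num)
  have h1 := (integral_eq_zero_iff_of_nonneg (fun _ ↦ by positivity) hi).1 h.symm
  have h2 : id =ᵐ[pdata] fun _ ↦ a := by
    filter_upwards [h1] with x hx
    simpa [sub_eq_zero] using hx
  have h3 := Measure.map_congr (mβ := inferInstance) h2
  rwa [Measure.map_id, Measure.map_const, measure_univ, one_smul] at h3

/-- A linear encoder and decoder along one coordinate beat the constant decoder. -/
theorem exists_admissible_reconError_lt (hdz : 0 < dz) (hcov : MemLp id 2 pdata)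
    (hL : 0 < L) (hnondeg : ∀ a : EuclideanSpace ℝ (Fin dx), pdata ≠ Measure.dirac a) :
    ∃ Q : VAEParams dx dz, Q.Admissible L ∧
      Q.reconError pdata < ENNReal.ofReal (∫ x, ‖x - ∫ y, y ∂pdata‖ ^ 2 ∂pdata) := by
  set m := ∫ y, y ∂pdata
  have hpos := integral_norm_sub_sq_pos_of_ne_dirac hcov (hnondeg m)
  have hc : MemLp (fun x ↦ x - m) 2 pdata := hcov.sub (memLp_const m)
  have hin : Integrable (fun x ↦ ‖x - m‖ ^ 2) pdata := hc.integrable_norm_pow (by norm_num)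
  have hie : ∀ e : EuclideanSpace ℝ (Fin dx),
      Integrable (fun x ↦ (inner ℝ e (x - m)) ^ 2) pdata :=
    fun e ↦ (hc.const_inner e).integrable_sq
  obtain ⟨e, he, hVe⟩ : ∃ e : EuclideanSpace ℝ (Fin dx), ‖e‖ = 1 ∧
      0 < ∫ x, (inner ℝ e (x - m)) ^ 2 ∂pdata := by
    have hsum : ∫ x, ‖x - m‖ ^ 2 ∂pdata
        = ∑ i, ∫ x, (inner ℝ (EuclideanSpace.basisFun (Fin dx) ℝ i) (x - m)) ^ 2 ∂pdata := by
      rw [← integral_finsetSum _ fun i _ ↦ hie _]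
      exact integral_congr_ae (ae_of_all _ fun x ↦
        ((EuclideanSpace.basisFun (Fin dx) ℝ).sum_sq_inner_right _).symm)
    rw [hsum] at hpos
    obtain ⟨i, -, hi⟩ := Finset.exists_ne_zero_of_sum_ne_zero hpos.ne'
    exact ⟨_, (EuclideanSpace.basisFun (Fin dx) ℝ).orthonormal.1 i,
      lt_of_le_of_ne (integral_nonneg fun _ ↦ by positivity) hi.symm⟩
  set W := ∫ x, (inner ℝ e (x - m)) ^ 2 ∂pdata
  -- Any finite positive slope below `L` suffices; this also covers `L = ∞`.
  obtain ⟨κ, hκ0, hκL⟩ := ENNReal.lt_iff_exists_nnreal_btwn.1 hL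
  have hκ : (0 : ℝ) < κ := by exact_mod_cast hκ0
  set u : EuclideanSpace ℝ (Fin dz) := EuclideanSpace.basisFun (Fin dz) ℝ ⟨0, hdz⟩
  have hu : ‖u‖ = 1 := (EuclideanSpace.basisFun (Fin dz) ℝ).orthonormal.1 _
  -- Minimizer of `β² (κ² W + 1) - 2 β κ W`, the change in error against the constant decoder `m` at
  -- latent variance 1.
  set β : ℝ := κ * W / (κ ^ 2 * W + 1)
  set Q : VAEParams dx dz :=
    { decMean := fun z ↦ m + (β * inner ℝ u z) • e
      encMean := fun x ↦ (κ * inner ℝ e (x - m)) • u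
      latentVar := 1 }
  have hQ : Q.Admissible L := by
    refine ⟨by simp only [Q]; fun_prop, ⟨κ, hκL.le, LipschitzWith.of_dist_le_mul fun x y ↦ ?_⟩, one_pos⟩
    simp only [Q, dist_eq_norm, ← sub_smul, norm_smul, hu, mul_one, ← mul_sub, ← inner_sub_right,
      sub_sub_sub_cancel_right, norm_mul, Real.norm_eq_abs, NNReal.abs_eq]
    gcongr
    simpa [he] using abs_real_inner_le_norm e (x - y)
  refine ⟨Q, hQ, ?_⟩
  have hpt : ∀ x ξ, ‖x - Q.decMean (Q.encMean x + √Q.latentVar • ξ)‖ ^ 2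
      = (‖x - m‖ ^ 2 - 2 * β * κ * inner ℝ e (x - m) ^ 2 + β ^ 2 * κ ^ 2 * inner ℝ e (x - m) ^ 2)
        + (2 * β ^ 2 * κ - 2 * β) * inner ℝ e (x - m) * inner ℝ u ξ
        + β ^ 2 * inner ℝ u ξ ^ 2 := by
    intro x ξ
    simp only [Q, Real.sqrt_one, one_smul, inner_add_right, real_inner_smul_right,
      real_inner_self_eq_norm_sq, hu]
    rw [← sub_sub, norm_sub_sq_real, norm_smul, mul_pow, he, real_inner_smul_right,
      real_inner_comm e, Real.norm_eq_abs, sq_abs]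
    ring
  have hinner : ∀ x, ∫⁻ ξ, ENNReal.ofReal
      (‖x - Q.decMean (Q.encMean x + √Q.latentVar • ξ)‖ ^ 2)
        ∂(stdGaussian (EuclideanSpace ℝ (Fin dz)))
      = ENNReal.ofReal (‖x - m‖ ^ 2 - 2 * β * κ * inner ℝ e (x - m) ^ 2
        + β ^ 2 * κ ^ 2 * inner ℝ e (x - m) ^ 2 + β ^ 2) := by
    intro x
    have hi1 : Integrable (fun ξ : EuclideanSpace ℝ (Fin dz) ↦
        (‖x - m‖ ^ 2 - 2 * β * κ * inner ℝ e (x - m) ^ 2 + β ^ 2 * κ ^ 2 * inner ℝ e (x - m) ^ 2)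
        + (2 * β ^ 2 * κ - 2 * β) * inner ℝ e (x - m) * inner ℝ u ξ) (stdGaussian _) :=
      (integrable_const _).add ((integrable_inner_stdGaussian u).const_mul _)
    have hi2 : Integrable (fun ξ : EuclideanSpace ℝ (Fin dz) ↦ β ^ 2 * inner ℝ u ξ ^ 2)
        (stdGaussian _) :=
      ((IsGaussian.memLp_two_id.const_inner (𝕜 := ℝ) u).integrable_sq).const_mul _
    rw [← ofReal_integral_eq_lintegral_ofReal]
    · simp_rw [hpt]
      rw [integral_add hi1 hi2, integral_add (integrable_const _)
        ((integrable_inner_stdGaussian u).const_mul _), integral_const_mul, integral_const_mul,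
        integral_inner_stdGaussian, integral_inner_sq_stdGaussian, hu]
      simp
    · simp_rw [hpt]
      exact hi1.add hi2
    · exact ae_of_all _ fun _ ↦ by positivity
  have hnn : ∀ x : EuclideanSpace ℝ (Fin dx), 0 ≤ ‖x - m‖ ^ 2 - 2 * β * κ * inner ℝ e (x - m) ^ 2
        + β ^ 2 * κ ^ 2 * inner ℝ e (x - m) ^ 2 + β ^ 2 := by
    intro x
    have h1 : inner ℝ e (x - m) ^ 2 ≤ ‖x - m‖ ^ 2 := by
      have := abs_real_inner_le_norm e (x - m)
      rw [he, one_mul] at this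
      rw [← sq_abs]
      gcongr
    nlinarith [mul_nonneg (sq_nonneg (β * κ - 1)) (sq_nonneg (inner ℝ e (x - m))), sq_nonneg β]
  have hval : Q.reconError pdata = ENNReal.ofReal (∫ x, ‖x - m‖ ^ 2 ∂pdata - 2 * β * κ * W
      + β ^ 2 * κ ^ 2 * W + β ^ 2) := by
    rw [reconError]
    simp_rw [hinner]
    have j1 := (hie e).const_mul (2 * β * κ)
    have j2 := (hie e).const_mul (β ^ 2 * κ ^ 2)
    rw [← ofReal_integral_eq_lintegral_ofReal
      (by exact ((hin.sub j1).add j2).add (integrable_const _))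
      (ae_of_all _ hnn), integral_add (by exact (hin.sub j1).add j2) (integrable_const _),
      integral_add (by exact hin.sub j1) j2, integral_sub hin j1, integral_const_mul,
      integral_const_mul]
    simp [W]
  rw [hval, ENNReal.ofReal_lt_ofReal_iff hpos]
  have hden : 0 < κ ^ 2 * W + 1 := by positivity
  have hβ : - (2 * β * κ * W) + β ^ 2 * κ ^ 2 * W + β ^ 2 = -((κ * W) ^ 2 / (κ ^ 2 * W + 1)) := by
    simp only [β]
    field_simp
    ring
  have : 0 < (κ * W) ^ 2 / (κ ^ 2 * W + 1) := by positivity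
  linarith

end VAEParams

/-! ### The contradiction for small decoder variance. -/

theorem theorem2 {dx dz : ℕ} (hdz : 0 < dz)
    (pdata : Measure (EuclideanSpace ℝ (Fin dx))) [IsProbabilityMeasure pdata]
    (hcov : MemLp id 2 pdata)
    (hnondeg : ∀ a : EuclideanSpace ℝ (Fin dx), pdata ≠ Measure.dirac a)
    (L : ℝ≥0∞) (hL : 0 < L) :
    ∀ ε : ℝ, 0 < ε → ∃ δ : ℝ, 0 < δ ∧ ∀ v : ℝ, 0 < v → v < δ →
      ∀ P : VAEParams dx dz, P.IsGlobalOptimum pdata L v → P.latentVar < ε := by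
  intro ε hε
  obtain ⟨Q, hQ, hQV⟩ := VAEParams.exists_admissible_reconError_lt hdz hcov hL hnondeg
  have hdz' : (0 : ℝ) < dz := by exact_mod_cast hdz
  have hQR : Q.reconError pdata ≠ ∞ := hQV.ne_top
  set V := ∫ x, ‖x - ∫ y, y ∂pdata‖ ^ 2 ∂pdata with hV
  set r := (Q.reconError pdata).toReal
  have hr0 : 0 ≤ r := ENNReal.toReal_nonneg
  have hrV : r < V := by
    rw [← ENNReal.ofReal_toReal hQR] at hQV
    exact (ENNReal.ofReal_lt_ofReal_iff_of_nonneg hr0).1 hQV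
  obtain ⟨η, hηV, hη0, hη1⟩ : ∃ η : ℝ, (1 + η) * r < (1 - η) * (V - η) ∧ 0 < η ∧ η < 1 := by
    have h1 : Tendsto (fun η : ℝ ↦ (1 - η) * (V - η) - (1 + η) * r) (𝓝[>] 0)
        (𝓝 ((1 - 0) * (V - 0) - (1 + 0) * r)) :=
      (Continuous.tendsto (by fun_prop) 0).mono_left nhdsWithin_le_nhds
    have h2 := (h1.eventually (lt_mem_nhds (show 0 < (1 - 0) * (V - 0) - (1 + 0) * r by
      linarith))).and (Ioo_mem_nhdsGT (show (0 : ℝ) < 1 by norm_num))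
    obtain ⟨η, h3, h4⟩ := h2.exists
    exact ⟨η, by linarith, h4.1, h4.2⟩
  obtain ⟨τ, hτ, hUI⟩ := exists_forall_variance_le_setIntegral_add hcov hη0
  -- `2 * dz` is the second-moment bound valid at every optimum, so Chebyshev gives one radius `M`
  -- independent of `v` and `P`.
  obtain ⟨M, hM, hMτ, hMη⟩ : ∃ M : ℝ, 0 < M ∧ 2 * dz / M ^ 2 ≤ τ ∧ 2 * dz / M ^ 2 ≤ η := by
    have h1 : 0 < 2 * dz / min τ η := by positivity
    refine ⟨√(2 * dz / min τ η), Real.sqrt_pos.2 h1, ?_⟩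
    rw [Real.sq_sqrt h1.le, div_div_cancel₀ (by positivity)]
    exact ⟨min_le_left _ _, min_le_right _ _⟩
  set k := ∫⁻ w : EuclideanSpace ℝ (Fin dz),
    ENNReal.ofReal (Real.exp (-((‖w‖ + 2 * M) ^ 2 / ε))) ∂(stdGaussian _) with hk
  have hk0 : k ≠ 0 := (lintegral_stdGaussian_exp_neg_pos M ε).ne'
  set C₀ := Q.meanKL pdata
  -- Bounds the KL term after halving: the second moments contribute at most `2 * dz`, and the
  -- halved variance is at least `ε / 2`.
  set C₁ : ℝ := (dz - dz * Real.log (ε / 2)) / 2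
  obtain ⟨δ, hδ, hδv⟩ : ∃ δ : ℝ, 0 < δ ∧ ∀ v : ℝ, 0 < v → v < δ →
      (1 + η) * (r + 2 * v * C₀) + (1 + η⁻¹) * (2 * v * C₁ / k.toReal) < (1 - η) * (V - η) := by
    have h1 : Tendsto (fun v : ℝ ↦ (1 + η) * (r + 2 * v * C₀)
        + (1 + η⁻¹) * (2 * v * C₁ / k.toReal)) (𝓝[>] 0)
        (𝓝 ((1 + η) * (r + 2 * 0 * C₀) + (1 + η⁻¹) * (2 * 0 * C₁ / k.toReal))) :=
      (Continuous.tendsto (by fun_prop) 0).mono_left nhdsWithin_le_nhds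
    have h2 := h1.eventually_lt_const (show _ < (1 - η) * (V - η) by simpa using hηV)
    obtain ⟨δ, hδ, hsub⟩ := mem_nhdsGT_iff_exists_Ioo_subset.1 h2
    exact ⟨δ, hδ, fun v h3 h4 ↦ hsub ⟨h3, h4⟩⟩
  refine ⟨δ, hδ, fun v hv hvδ P hP ↦ ?_⟩
  by_contra! hεs
  have hPR := hP.reconError_ne_top hcov hv hQ hQR
  have hmom := hP.second_moment_le hcov hv hPR
  have hs0 := hP.1.latentVar_pos
  have hE0 : 0 ≤ ∫ x, ‖P.encMean x‖ ^ 2 ∂pdata := integral_nonneg fun _ ↦ by positivity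
  have hs2 : P.latentVar ≤ 2 := by nlinarith
  have hEM : ∫ x, ‖P.encMean x‖ ^ 2 ∂pdata ≤ 2 * dz := by nlinarith
  have hsum := VAEParams.reconError_eq_add_smoothingGap hP.1 hPR
  have hHR : P.halve.reconError pdata ≠ ∞ := by
    rw [hsum] at hPR
    exact (ENNReal.add_ne_top.1 hPR).1
  have hGR : P.smoothingGap pdata ≠ ∞ := by
    rw [hsum] at hPR
    exact (ENNReal.add_ne_top.1 hPR).2
  have hsum' : (P.reconError pdata).toReal
      = (P.halve.reconError pdata).toReal + (P.smoothingGap pdata).toReal := by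
    rw [hsum, ENNReal.toReal_add hHR hGR]
  have hKP : 0 ≤ 2 * v * P.meanKL pdata := mul_nonneg (by positivity) hP.1.meanKL_nonneg
  have hle := hP.toReal_le hcov hv hQ hQR
  have hleH := hP.toReal_le hcov hv hP.1.halve hHR
  have hG0 : 0 ≤ (P.smoothingGap pdata).toReal := ENNReal.toReal_nonneg
  have hKH : P.halve.meanKL pdata ≤ C₁ := by
    have h1 : Real.log (ε / 2) ≤ Real.log (P.latentVar / 2) :=
      Real.log_le_log (by positivity) (by linarith)
    have h2 : (dz : ℝ) * Real.log (ε / 2) ≤ dz * Real.log (P.latentVar / 2) := by gcongr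
    have h3 : 0 < dz * P.latentVar := by positivity
    simp only [VAEParams.meanKL, VAEParams.halve, C₁]
    linarith
  -- Optimality against `P.halve`, with the nonnegative KL term of `P` dropped.
  have hG : (P.smoothingGap pdata).toReal ≤ 2 * v * C₁ := by
    have : 2 * v * P.halve.meanKL pdata ≤ 2 * v * C₁ := by gcongr
    linarith
  obtain ⟨c, hc⟩ := VAEParams.exists_measure_mul_setLIntegral_le (pdata := pdata) hP.1 hε hεs hs2
    M hη0
  rw [← hk] at hc
  have hμ := hP.1.continuous_encMean
  have hD : MeasurableSet {x | ‖P.encMean x‖ ≤ M} := measurableSet_le (by fun_prop) (by fun_prop)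
  have hB : MeasurableSet {a : EuclideanSpace ℝ (Fin dz) | ‖a‖ ≤ M} :=
    measurableSet_le (by fun_prop) (by fun_prop)
  have hUIc := hUI _ hD ((measure_compl_norm_le_le_of_integral_sq_le
    (hP.1.integrable_norm_encMean_sq hcov) hM hEM).trans (ENNReal.ofReal_le_ofReal hMτ)) c
  have hγ : 1 - η ≤ (stdGaussian (EuclideanSpace ℝ (Fin dz))).real {a | ‖a‖ ≤ M} := by
    -- The second moment here is `dz`; the weaker `2 * dz` lets the same `M` serve the encoder mean
    -- and the noise.
    have h1 := measure_compl_norm_le_le_of_integral_sq_le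
      (integrable_norm_sq_stdGaussian (V := EuclideanSpace ℝ (Fin dz))) hM
      (C := 2 * dz) (by rw [integral_norm_sq_stdGaussian, finrank_euclideanSpace_fin]; linarith)
    have h2 := ENNReal.toReal_le_of_le_ofReal hη0.le (h1.trans (ENNReal.ofReal_le_ofReal hMη))
    have h3 := probReal_compl_eq_one_sub (μ := stdGaussian (EuclideanSpace ℝ (Fin dz))) hB
    rw [measureReal_def] at h3
    linarith
  have hfin : ENNReal.ofReal (1 + η) * P.halve.reconError pdata
      + ENNReal.ofReal (1 + η⁻¹) * (P.smoothingGap pdata / k) ≠ ∞ :=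
    ENNReal.add_ne_top.2 ⟨ENNReal.mul_ne_top ENNReal.ofReal_ne_top hHR,
      ENNReal.mul_ne_top ENNReal.ofReal_ne_top (ENNReal.div_ne_top hGR hk0)⟩
  have hcr := ENNReal.toReal_mono hfin hc
  rw [lintegral_ofReal_norm_sq_eq (F := fun x ↦ x - c) ((hcov.sub (memLp_const c)).restrict _),
    ENNReal.toReal_add (ENNReal.add_ne_top.1 hfin).1 (ENNReal.add_ne_top.1 hfin).2,
    ENNReal.toReal_mul, ENNReal.toReal_mul, ENNReal.toReal_mul, ENNReal.toReal_div,
    ENNReal.toReal_ofReal (integral_nonneg fun _ ↦ by positivity),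
    ENNReal.toReal_ofReal (by positivity), ENNReal.toReal_ofReal (by positivity), ← measureReal_def] at hcr
  have hI0 : 0 ≤ ∫ x in {x | ‖P.encMean x‖ ≤ M}, ‖x - c‖ ^ 2 ∂pdata :=
    integral_nonneg fun _ ↦ by positivity
  have hfinal := hδv v hv hvδ
  have h1 : (1 - η) * (V - η) ≤ (1 - η) * ∫ x in {x | ‖P.encMean x‖ ≤ M}, ‖x - c‖ ^ 2 ∂pdata := by
    refine mul_le_mul_of_nonneg_left ?_ (by linarith)
    simp only [id_eq, ← hV] at hUIc
    linarith
  have h2 := mul_le_mul_of_nonneg_right hγ hI0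
  have h3 : (1 + η) * (P.halve.reconError pdata).toReal ≤ (1 + η) * (r + 2 * v * C₀) := by
    gcongr
    linarith
  have h4 : (1 + η⁻¹) * ((P.smoothingGap pdata).toReal / k.toReal)
      ≤ (1 + η⁻¹) * (2 * v * C₁ / k.toReal) := by gcongr
  linarith
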